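/- All groups are finite. Call a subgroup $H$ of a group $G$ *$\mathbb P$-subnormal* in $G$ if either $H=G$ or there is a chain of subgroups $H=H_0\le H_1\le\dots\le H_n=G$ such that $|H_i:H_{i-1}|$ is a prime for every $i=1,\dots,n$. Call a group *w-supersoluble* if each of its Sylow subgroups is $\mathbb P$-subnormal in it, and *siding* if every subgroup of its derived subgroup is normal in the group. **Theorem 2.4.** Let $G$ be a finite group, let $A$ be a w-supersoluble $\mathbb P$-subnormal subgroup of $G$, let $B$ be a subgroup of $G$, and suppose that $G=AB$. Then $G$ is w-supersoluble in each of the following cases: 1. $B$ is nilpotent and normal in $G$; 2. $B$ is nilpotent and $|G:B|$ is a prime; 3. $B$ is normal in $G$ and is a siding group. -/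

import Mathlib

open scoped Pointwise

/-- `H` is `ℙ`-subnormal in `G`: there is a chain `H = C 0 ≤ C 1 ≤ ⋯ ≤ C n = G` of subgroups
in which every index `|C (i+1) : C i|` is prime. The case `H = G` is the chain of length `n = 0`. -/
def IsPSubnormal {G : Type*} [Group G] (H : Subgroup G) : Prop :=
  ∃ (n : ℕ) (C : ℕ → Subgroup G), C 0 = H ∧ C n = ⊤ ∧
    ∀ i < n, C i ≤ C (i + 1) ∧ ((C i).relIndex (C (i + 1))).Prime

/-- A group is w-supersoluble (widely supersoluble) if each of its Sylow subgroups is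
`ℙ`-subnormal in it. -/
def IsWSupersoluble (G : Type*) [Group G] : Prop :=
  ∀ p : ℕ, p.Prime → ∀ P : Sylow p G, IsPSubnormal (P : Subgroup G)

/-- A group is siding if every subgroup of its derived subgroup is normal in the whole group. -/
def IsSiding (G : Type*) [Group G] : Prop :=
  ∀ H : Subgroup G, H ≤ commutator G → H.Normal

/-!
A subgroup is `ℙ`-subnormal when it can be joined to the whole group by steps of prime index; this
is treated here as the reflexive transitive closure of the relation `PrimeStep`. As all Sylow
`p`-subgroups are conjugate, it suffices, for each prime `p`, to exhibit one which is
`ℙ`-subnormal. Take a Sylow `p`-subgroup `Q` of `A`, which is `ℙ`-subnormal in `A` and hence in `G`,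
and a Sylow `p`-subgroup `P` of `G` containing `Q`. The aim is to pass from `Q` to `P`, and the main
tool is that joining with a normal subgroup preserves `ℙ`-subnormality
(`PrimeChain.sup_normal`).

* If `B` is normal, then `P = Q (P ∩ B)` (`sylow_eq_sup_inf`). If `B` is moreover nilpotent, then
  `P ∩ B`, its Sylow `p`-subgroup, is normal in `G`, and the tool applies.
* If `B` is nilpotent of prime index `q ≠ p`, then `B` contains a Sylow `p`-subgroup of `G`, and
  every subgroup of a nilpotent group is `ℙ`-subnormal. If `q = p`, the Sylow `p`-subgroup `N` of
  `B` is normalized by `B` and, being a proper subgroup of a `p`-group, also by an element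
  outside the maximal subgroup `B`; so it is normal in `G`. It has index `p` in `P`, and `Q` is not
  contained in `N` because `|A : A ∩ B| = p`; hence `P = Q N`.
* If `B` is normal and siding, let `D` be its derived subgroup. The Frattini argument shows that
  `(P ∩ B) D` is normal in `G`, so `P D = Q (P ∩ B) D` is `ℙ`-subnormal. A chain `H₀ ≤ H₁ ≤ ⋯` from
  `Q` to `G` yields the chain of the `P (Hᵢ ∩ D)` from `P` to `P D`: the subgroup `Hᵢ ∩ D` is
  normalized by `Q ≤ Hᵢ` and, as `B` is siding, by `P ∩ B`, hence by `P`
  (`PrimeChain.sup_inf_normal`).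
-/

open Subgroup Relation
open scoped commutatorElement

/-! ### Indices of subgroups in a product -/

section Index

variable {G : Type*} [Group G]

/-- If `H ≤ L ⊆ H K`, then `|L : L ∩ K| = |H : H ∩ K|`. -/
theorem relIndex_eq_of_subset_mul {H K L : Subgroup G} (hH : H ≤ L)
    (h : ∀ x ∈ L, ∃ a ∈ H, ∃ b ∈ K, a * b = x) : K.relIndex L = K.relIndex H := by
  symm
  refine Nat.card_congr (Equiv.ofBijective (quotientSubgroupOfEmbeddingOfLE K hH)
    ⟨(quotientSubgroupOfEmbeddingOfLE K hH).injective, fun y => ?_⟩)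
  induction y using QuotientGroup.induction_on with
  | H x =>
    obtain ⟨a, ha, b, hb, hab⟩ := h x x.2
    refine ⟨QuotientGroup.mk ⟨a, ha⟩, ?_⟩
    rw [quotientSubgroupOfEmbeddingOfLE_apply_mk, QuotientGroup.eq, mem_subgroupOf]
    have : a⁻¹ * (x : G) = b := by rw [← hab]; group
    simpa [this] using hb

theorem relIndex_sup_of_le_normalizer {P K : Subgroup G} (h : P ≤ normalizer (K : Set G)) :
    P.relIndex (P ⊔ K) = P.relIndex K := by
  refine relIndex_eq_of_subset_mul le_sup_right fun x hx => ?_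
  rw [← SetLike.mem_coe, sup_comm, coe_mul_of_right_le_normalizer_left K P h] at hx
  simpa [Set.mem_mul] using hx

theorem isCoatom_of_index_prime {B : Subgroup G} (hB : B.index.Prime) : IsCoatom B := by
  refine ⟨fun h => Nat.not_prime_one (by simpa [h] using hB), fun K hK => ?_⟩
  rcases (Nat.dvd_prime hB).1 (index_dvd_of_le hK.le) with h | h
  · exact index_eq_one.1 h
  · have := relIndex_mul_index hK.le
    rw [h] at this
    have h1 : B.relIndex K = 1 := Nat.eq_of_mul_eq_mul_right hB.pos (by simpa using this)
    exact absurd (relIndex_eq_one.1 h1) (not_le_of_gt hK)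

end Index

/-! ### Chains of subgroups with prime indices -/

section PrimeChain

variable {G : Type*} [Group G]

/-- `H` is a subgroup of `K` of prime index. -/
def PrimeStep (H K : Subgroup G) : Prop := H ≤ K ∧ (H.relIndex K).Prime

/-- `H` can be joined to `K` by a (possibly trivial) chain of subgroups with prime indices. -/
abbrev PrimeChain (H K : Subgroup G) : Prop := ReflTransGen PrimeStep H K

theorem isPSubnormal_iff_primeChain {H : Subgroup G} : IsPSubnormal H ↔ PrimeChain H ⊤ := by
  constructor
  · rintro ⟨n, C, rfl, hn, hC⟩
    rw [← hn]
    have : ∀ m ≤ n, PrimeChain (C 0) (C m) := by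
      intro m
      induction m with
      | zero => exact fun _ => .refl
      | succ m ih => exact fun hm => (ih (by omega)).tail (hC m (by omega))
    exact this n le_rfl
  · intro h
    induction h using ReflTransGen.head_induction_on with
    | refl => exact ⟨0, fun _ => ⊤, rfl, rfl, by simp⟩
    | @head H K hHK _ ih =>
      obtain ⟨n, C, h0, hn, hC⟩ := ih
      refine ⟨n + 1, fun i => i.casesOn H C, rfl, hn, fun i hi => ?_⟩
      cases i with
      | zero =>
        change PrimeStep H (C 0)
        rwa [h0]
      | succ i => exact hC i (by omega)

theorem PrimeChain.le {H K : Subgroup G} (h : PrimeChain H K) : H ≤ K := by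
  induction h with
  | refl => exact le_rfl
  | tail _ hs ih => exact ih.trans hs.1

theorem PrimeChain.of_dvd {H K : Subgroup G} {q : ℕ} (hHK : H ≤ K) (hq : q.Prime)
    (h : H.relIndex K ∣ q) : PrimeChain H K := by
  rcases (Nat.dvd_prime hq).1 h with h | h
  · rw [le_antisymm hHK (relIndex_eq_one.1 h)]
  · exact .single ⟨hHK, h ▸ hq⟩

theorem PrimeChain.map {G' : Type*} [Group G'] {H K : Subgroup G} (h : PrimeChain H K)
    {f : G →* G'} (hf : Function.Injective f) : PrimeChain (H.map f) (K.map f) :=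
  ReflTransGen.lift (Subgroup.map f) (fun _ _ hs =>
    ⟨map_mono hs.1, by rw [relIndex_map_map_of_injective _ _ hf]; exact hs.2⟩) _ _ h

theorem PrimeChain.sup_normal {H K : Subgroup G} (h : PrimeChain H K) (N : Subgroup G)
    [N.Normal] : PrimeChain (H ⊔ N) (K ⊔ N) := by
  refine ReflTransGen.lift' (· ⊔ N) (fun H K hs => ?_) _ _ h
  refine PrimeChain.of_dvd (sup_le_sup_right hs.1 N) hs.2 ?_
  have : (H ⊔ N).relIndex (K ⊔ N) = (H ⊔ N).relIndex K := by
    refine relIndex_eq_of_subset_mul le_sup_left fun x hx => ?_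
    obtain ⟨a, ha, b, hb, rfl⟩ := mem_sup_of_normal_right.1 hx
    exact ⟨a, ha, b, le_sup_right (a := H) hb, rfl⟩
  rw [this]
  exact relIndex_dvd_of_le_left K le_sup_left

/-- A chain starting above `Q`, intersected with a normal subgroup `D` and then joined with `P`,
is again a chain, if `P` normalizes the intersections that occur. -/
theorem PrimeChain.sup_inf_normal {Q P D K : Subgroup G} [D.Normal]
    (hP : ∀ H, Q ≤ H → P ≤ normalizer ((H ⊓ D : Subgroup G) : Set G))
    {H : Subgroup G} (hQH : Q ≤ H) (h : PrimeChain H K) :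
    PrimeChain (P ⊔ (H ⊓ D)) (P ⊔ (K ⊓ D)) := by
  induction h with
  | refl => exact .refl
  | @tail L M hL hs ih =>
    refine ih.trans ?_
    have hLD : L ⊓ D ≤ M ⊓ D := inf_le_inf_right D hs.1
    refine PrimeChain.of_dvd (sup_le_sup_left hLD P) hs.2 ?_
    have hQM : Q ≤ M := (hQH.trans (PrimeChain.le hL)).trans hs.1
    -- The index of `P (L ∩ D)` in `P (M ∩ D)` divides `|M ∩ D : L ∩ D|`.
    have h1 : (P ⊔ (L ⊓ D)).relIndex (P ⊔ (M ⊓ D)) = (P ⊔ (L ⊓ D)).relIndex (M ⊓ D) := by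
      refine relIndex_eq_of_subset_mul le_sup_right fun x hx => ?_
      rw [← SetLike.mem_coe, sup_comm, coe_mul_of_right_le_normalizer_left _ P (hP M hQM)] at hx
      obtain ⟨a, ha, b, hb, rfl⟩ := hx
      exact ⟨a, ha, b, le_sup_left (a := P) hb, rfl⟩
    -- The latter is the index of `L` in `L (M ∩ D) ≤ M`.
    have h2 : (L ⊓ D).relIndex (M ⊓ D) = L.relIndex (M ⊓ D) := by
      rw [← inf_relIndex_right L (M ⊓ D), ← inf_relIndex_right (L ⊓ D) (M ⊓ D)]
      congr 1
      ext x
      simp only [mem_inf]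
      tauto
    have h3 : L ≤ normalizer ((M ⊓ D : Subgroup G) : Set G) := by
      refine le_normalizer_iff.2 fun l hl m hm => ⟨?_, ?_⟩
      · exact mul_mem (mul_mem (hs.1 hl) hm.1) (M.inv_mem (hs.1 hl))
      · exact Normal.conj_mem inferInstance m hm.2 l
    rw [h1]
    refine (relIndex_dvd_of_le_left _ le_sup_right).trans ?_
    rw [h2, ← relIndex_sup_of_le_normalizer h3,
      ← relIndex_mul_relIndex L (L ⊔ (M ⊓ D)) M le_sup_left (sup_le hs.1 inf_le_left)]
    exact dvd_mul_right _ _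

theorem exists_primeStep_of_lt_normalizer [Finite G] {H : Subgroup G}
    (h : H < normalizer (H : Set G)) : ∃ K, PrimeStep H K := by
  set N := normalizer (H : Set G)
  have hHN : H ≤ N := h.le
  have hnt : Nontrivial (N ⧸ H.subgroupOf N) := by
    rw [QuotientGroup.nontrivial_iff, Ne, subgroupOf_eq_top]
    exact not_le_of_gt h
  have hp := Nat.minFac_prime (Finite.one_lt_card (α := N ⧸ H.subgroupOf N)).ne'
  have : Fact (Nat.minFac (Nat.card (N ⧸ H.subgroupOf N))).Prime := ⟨hp⟩
  obtain ⟨x, hx⟩ := exists_prime_orderOf_dvd_card' _ (Nat.minFac_dvd (Nat.card (N ⧸ H.subgroupOf N)))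
  set f := QuotientGroup.mk' (H.subgroupOf N)
  have hH : H = ((⊥ : Subgroup (N ⧸ H.subgroupOf N)).comap f).map N.subtype := by
    rw [MonoidHom.comap_bot, QuotientGroup.ker_mk', subgroupOf_map_subtype, inf_eq_left.2 hHN]
  refine ⟨((zpowers x).comap f).map N.subtype, ?_, ?_⟩
  · exact hH.trans_le (map_mono (comap_mono bot_le))
  · have hidx := congrArg (·.relIndex (((zpowers x).comap f).map N.subtype)) hH
    beta_reduce at hidx
    rw [hidx, relIndex_map_map_of_injective _ _ N.subtype_injective, relIndex_comap,
      map_comap_eq_self_of_surjective (QuotientGroup.mk'_surjective _), relIndex_bot_left,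
      Nat.card_zpowers, hx]
    exact hp

/-- Every subgroup of a finite nilpotent group is `ℙ`-subnormal, by the normalizer condition. -/
theorem primeChain_top_of_isNilpotent [Finite G] [Group.IsNilpotent G] (H : Subgroup G) :
    PrimeChain H ⊤ := by
  induction H using WellFoundedGT.induction with
  | _ H ih =>
    rcases eq_or_ne H ⊤ with rfl | hH
    · exact .refl
    · obtain ⟨K, hK⟩ := exists_primeStep_of_lt_normalizer
        (Group.normalizerCondition_of_isNilpotent (G := G) H hH.lt_top)
      refine .head hK (ih K (lt_of_le_of_ne hK.1 ?_))
      rintro rfl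
      exact Nat.not_prime_one (relIndex_self H ▸ hK.2)

end PrimeChain

/-! ### Sylow subgroups of a product -/

section Sylow

variable {G : Type*} [Group G] {p : ℕ} [Fact p.Prime]

theorem not_dvd_relIndex_map_subtype [Finite G] {A : Subgroup G} (Q : Sylow p A) :
    ¬ p ∣ ((Q : Subgroup A).map A.subtype).relIndex A := by
  have : ((Q : Subgroup A).map A.subtype).relIndex A = (Q : Subgroup A).index := by
    have h := relIndex_map_map_of_injective (Q : Subgroup A) ⊤ A.subtype_injective
    rwa [← MonoidHom.range_eq_map, A.range_subtype, relIndex_top_right] at h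
  rw [this]
  exact Q.not_dvd_index

/-- Any two Sylow subgroups are conjugate, so one `ℙ`-subnormal one suffices. -/
theorem primeChain_top_of_sylow [Finite G] {P : Sylow p G} (h : PrimeChain (P : Subgroup G) ⊤)
    (P' : Sylow p G) : PrimeChain (P' : Subgroup G) ⊤ := by
  obtain ⟨g, rfl⟩ := MulAction.exists_smul_eq G P P'
  have := PrimeChain.map h (f := (MulAut.conj g).toMonoidHom) (MulAut.conj g).injective
  rwa [map_top_of_surjective _ (MulAut.conj g).surjective] at this

theorem eq_one_of_dvd_card_of_dvd_index [Finite G] (P : Sylow p G) {n : ℕ}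
    (h1 : n ∣ Nat.card P) (h2 : ¬ p ∣ n) : n = 1 := by
  obtain ⟨k, hk⟩ := P.isPGroup'.exists_card_eq
  rw [hk] at h1
  obtain ⟨j, _, rfl⟩ := (Nat.dvd_prime_pow Fact.out).1 h1
  cases j with
  | zero => rfl
  | succ j => exact absurd (dvd_pow_self p j.succ_ne_zero) h2

/-- Write `Q` also for its image in `G`. Since `G = AB`, the index of `Q B` in `G` is prime to `p`,
so `Q B` contains `P`; the modular law then gives `P = Q (P ∩ B)`. -/
theorem sylow_eq_sup_inf [Finite G] {A B : Subgroup G} [B.Normal] (hAB : A ⊔ B = ⊤)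
    {Q : Sylow p A} {P : Sylow p G} (hQP : (Q : Subgroup A).map A.subtype ≤ P) :
    (P : Subgroup G) = (Q : Subgroup A).map A.subtype ⊔ (P ⊓ B) := by
  set Q' := (Q : Subgroup A).map A.subtype
  have hle : Q' ≤ A := map_subtype_le _
  have hidx : ¬ p ∣ (Q' ⊔ B).index := by
    have : (Q' ⊔ B).relIndex ⊤ = (Q' ⊔ B).relIndex A := by
      refine relIndex_eq_of_subset_mul le_top fun x _ => ?_
      obtain ⟨a, ha, b, hb, rfl⟩ := mem_sup_of_normal_right.1 (hAB ▸ mem_top x : x ∈ A ⊔ B)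
      exact ⟨a, ha, b, le_sup_right (a := Q') hb, rfl⟩
    rw [← relIndex_top_right, this]
    exact fun h => not_dvd_relIndex_map_subtype Q
      (h.trans (relIndex_dvd_of_le_left A le_sup_left))
  have hPB : (Q' ⊔ B).relIndex (P ⊔ B) = (Q' ⊔ B).relIndex P := by
    refine relIndex_eq_of_subset_mul le_sup_left fun x hx => ?_
    obtain ⟨a, ha, b, hb, rfl⟩ := mem_sup_of_normal_right.1 hx
    exact ⟨a, ha, b, le_sup_right (a := Q') hb, rfl⟩
  have hPle : (P : Subgroup G) ≤ Q' ⊔ B := by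
    rw [← relIndex_eq_one]
    refine eq_one_of_dvd_card_of_dvd_index P (relIndex_dvd_card _ _) fun h => hidx ?_
    rw [← hPB] at h
    exact h.trans (relIndex_dvd_index_of_le (sup_le_sup_right hQP B))
  refine le_antisymm (fun x hx => ?_) (sup_le hQP inf_le_left)
  obtain ⟨a, ha, b, hb, rfl⟩ := mem_sup_of_normal_right.1 (hPle hx)
  exact mul_mem (le_sup_left (a := Q') ha)
    (le_sup_right (a := Q') ⟨(mul_mem_cancel_left (hQP ha)).1 hx, hb⟩)

/-- The intersection of a Sylow subgroup of `G` with a normal subgroup `B` is Sylow in `B`. -/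
theorem exists_sylow_map_eq_inf [Finite G] (P : Sylow p G) (B : Subgroup G) [B.Normal] :
    ∃ R : Sylow p B, (R : Subgroup B).map B.subtype = (P : Subgroup G) ⊓ B := by
  have hp : IsPGroup p ((P : Subgroup G).subgroupOf B) :=
    P.isPGroup'.comap_of_injective B.subtype B.subtype_injective
  have hidx : ¬ p ∣ ((P : Subgroup G).subgroupOf B).index := by
    intro h
    change p ∣ (P : Subgroup G).relIndex B at h
    rw [← relIndex_sup_of_le_normalizer (P := P) (K := B) le_normalizer_of_normal] at h
    exact P.not_dvd_index (h.trans (relIndex_dvd_index_of_le le_sup_left))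
  exact ⟨hp.toSylow hidx, by rw [IsPGroup.toSylow_coe, subgroupOf_map_subtype]⟩

end Sylow

/-! ### Siding subgroups -/

/-- The siding condition, for a subgroup `B` of `G`: `B` normalizes each subgroup of `[B, B]`. -/
theorem IsSiding.le_normalizer {G : Type*} [Group G] {B : Subgroup G} (hB : IsSiding B) {K : Subgroup G} (hK : K ≤ ⁅B, B⁆) :
    B ≤ normalizer (K : Set G) := by
  have hKB : K ≤ B := hK.trans (commutator_le_self B)
  have hn : (K.subgroupOf B).Normal := by
    refine hB _ ?_
    rw [← map_subtype_le_map_subtype, map_subtype_commutator, subgroupOf_map_subtype,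
      inf_eq_left.2 hKB]
    exact hK
  refine le_normalizer_iff.2 fun b hb k hk => ?_
  exact hn.conj_mem ⟨k, hKB hk⟩ hk ⟨b, hb⟩

/-! ### The Sylow subgroups in the three cases -/

section Cases

variable {G : Type*} [Group G] [Finite G] {p : ℕ} [Fact p.Prime] {A B : Subgroup G}

theorem primeChain_sylow_of_nilpotent_normal (hAB : A ⊔ B = ⊤) [B.Normal] [Group.IsNilpotent B]
    {Q : Sylow p A} (hQ : PrimeChain ((Q : Subgroup A).map A.subtype) ⊤)
    {P : Sylow p G} (hQP : (Q : Subgroup A).map A.subtype ≤ P) :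
    PrimeChain (P : Subgroup G) ⊤ := by
  obtain ⟨R, hR⟩ := exists_sylow_map_eq_inf P B
  have : (R : Subgroup B).Normal :=
    R.normal_of_normalizerCondition Group.normalizerCondition_of_isNilpotent
  have := R.characteristic_of_normal this
  have : ((P : Subgroup G) ⊓ B).Normal := by rw [← hR]; infer_instance
  rw [sylow_eq_sup_inf hAB hQP]
  simpa using PrimeChain.sup_normal hQ ((P : Subgroup G) ⊓ B)

/-- For `p ≠ |G : B|`, a Sylow `p`-subgroup of `B` is Sylow in `G`. -/
theorem primeChain_sylow_of_index_ne (hB : B.index.Prime) [Group.IsNilpotent B]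
    (hp : B.index ≠ p) (P : Sylow p G) : PrimeChain (P : Subgroup G) ⊤ := by
  obtain ⟨R⟩ : Nonempty (Sylow p B) := inferInstance
  have hRp : IsPGroup p ((R : Subgroup B).map B.subtype) := R.isPGroup'.map _
  have hidx : ¬ p ∣ ((R : Subgroup B).map B.subtype).index := by
    rw [← relIndex_mul_index (map_subtype_le (R : Subgroup B)),
      (Fact.out : p.Prime).dvd_mul, not_or]
    exact ⟨not_dvd_relIndex_map_subtype R,
      fun h => hp ((Nat.prime_dvd_prime_iff_eq Fact.out hB).1 h).symm⟩
  refine primeChain_top_of_sylow (P := hRp.toSylow hidx) ?_ P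
  rw [IsPGroup.toSylow_coe]
  have h1 := PrimeChain.map (primeChain_top_of_isNilpotent (R : Subgroup B)) B.subtype_injective
  rw [← MonoidHom.range_eq_map, B.range_subtype] at h1
  exact h1.tail ⟨le_top, by rwa [relIndex_top_right]⟩

/-- If `B` is nilpotent of index `p`, then its Sylow `p`-subgroup is normal in `G`. -/
theorem normal_map_sylow_of_index_eq (hB : B.index = p) [Group.IsNilpotent B]
    (R : Sylow p B) : ((R : Subgroup B).map B.subtype).Normal := by
  have hpp : p.Prime := Fact.out
  set N := (R : Subgroup B).map B.subtype
  have hNB : N ≤ B := map_subtype_le _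
  have hNp : IsPGroup p N := R.isPGroup'.map _
  obtain ⟨P, hNP⟩ := hNp.exists_le_sylow
  have hBN : B ≤ normalizer (N : Set G) := by
    have : (R : Subgroup B).Normal :=
      R.normal_of_normalizerCondition Group.normalizerCondition_of_isNilpotent
    refine le_normalizer_iff.2 ?_
    rintro b hb _ ⟨r, hr, rfl⟩
    exact ⟨⟨b, hb⟩ * r * ⟨b, hb⟩⁻¹, this.conj_mem r hr _, rfl⟩
  have hlt : N.subgroupOf P < ⊤ := by
    refine lt_top_iff_ne_top.2 fun h => P.not_dvd_index ?_
    have hPB : (P : Subgroup G) ≤ B := (subgroupOf_eq_top.1 h).trans hNB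
    rw [← relIndex_mul_index hPB, hB]
    exact dvd_mul_left _ _
  have := P.isPGroup'.isNilpotent
  obtain ⟨x, hxn, hxN⟩ := SetLike.exists_of_lt
    (Group.normalizerCondition_of_isNilpotent (G := P) _ hlt)
  have hxn' : (x : G) ∈ normalizer (N : Set G) := by
    rw [← subgroupOf_normalizer_eq hNP] at hxn
    exact hxn
  -- The `p`-subgroup `P ∩ B` of `B` contains the Sylow subgroup `N`, hence equals it.
  have hxB : (x : G) ∉ B := by
    intro hxB
    have hle : (R : Subgroup B) ≤ (P : Subgroup G).subgroupOf B := by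
      intro r hr
      exact hNP ⟨r, hr, rfl⟩
    have hp : IsPGroup p ((P : Subgroup G).subgroupOf B) :=
      P.isPGroup'.comap_of_injective B.subtype B.subtype_injective
    have heq := R.is_maximal' hp hle
    have : (⟨x, hxB⟩ : B) ∈ (P : Subgroup G).subgroupOf B := x.2
    rw [heq] at this
    exact hxN ⟨_, this, rfl⟩
  rw [← normalizer_eq_top_iff]
  exact (isCoatom_of_index_prime (hB ▸ hpp)).2 _
    (lt_of_le_of_ne hBN fun h => hxB (h ▸ hxn'))

theorem primeChain_sylow_of_index_eq (hAB : ∀ x : G, ∃ a ∈ A, ∃ b ∈ B, a * b = x)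
    (hB : B.index = p) [Group.IsNilpotent B]
    {Q : Sylow p A} (hQ : PrimeChain ((Q : Subgroup A).map A.subtype) ⊤)
    {P : Sylow p G} (hQP : (Q : Subgroup A).map A.subtype ≤ P) :
    PrimeChain (P : Subgroup G) ⊤ := by
  have hpp : p.Prime := Fact.out
  obtain ⟨R⟩ : Nonempty (Sylow p B) := inferInstance
  have hN := normal_map_sylow_of_index_eq hB R
  have hNR := not_dvd_relIndex_map_subtype R
  have hNB : (R : Subgroup B).map B.subtype ≤ B := map_subtype_le _
  have hNp : IsPGroup p ((R : Subgroup B).map B.subtype) := R.isPGroup'.map _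
  set N := (R : Subgroup B).map B.subtype
  set Q' := (Q : Subgroup A).map A.subtype
  have hNP : N ≤ P := hNp.le_sylow_of_normal P
  -- `|G : N|` is `p` times a number prime to `p`, so the `p`-power `|P : N|` divides `p`.
  have hdvd : N.relIndex P ∣ p := by
    have h1 : N.relIndex P ∣ N.relIndex B * p := by
      have h2 := relIndex_mul_index hNB
      rw [hB, ← relIndex_mul_index hNP] at h2
      exact Dvd.intro _ h2.symm
    obtain ⟨k, hk⟩ := P.isPGroup'.exists_card_eq
    refine Nat.Coprime.dvd_of_dvd_mul_left ?_ h1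
    refine Nat.Coprime.coprime_dvd_left (relIndex_dvd_card N P) ?_
    rw [hk]
    exact Nat.Coprime.pow_left k ((Nat.Prime.coprime_iff_not_dvd hpp).2 hNR)
  have hQN : ¬ Q' ≤ N := by
    intro h
    apply not_dvd_relIndex_map_subtype Q
    have h2 : B.relIndex A = p := by
      rw [← hB, ← relIndex_top_right,
        relIndex_eq_of_subset_mul (K := B) (le_top : A ≤ ⊤) fun x _ => hAB x]
    have h3 := relIndex_dvd_of_le_left A (h.trans hNB)
    rwa [h2] at h3
  have hle : Q' ⊔ N ≤ P := sup_le hQP hNP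
  have heq : (P : Subgroup G) = Q' ⊔ N := by
    refine le_antisymm (relIndex_eq_one.1 ?_) hle
    have hmul := relIndex_mul_relIndex N (Q' ⊔ N) P le_sup_right hle
    rcases (Nat.dvd_prime hpp).1 ((Dvd.intro _ hmul).trans hdvd) with h | h
    · exact absurd (le_sup_left.trans (relIndex_eq_one.1 h)) hQN
    · have h4 : p * (Q' ⊔ N).relIndex P ∣ p * 1 := by
        rw [h] at hmul
        rwa [hmul, mul_one]
      exact Nat.dvd_one.1 (Nat.dvd_of_mul_dvd_mul_left hpp.pos h4)
  rw [heq]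
  simpa using PrimeChain.sup_normal hQ N

theorem primeChain_sylow_of_siding (hAB : A ⊔ B = ⊤) [B.Normal] (hB : IsSiding B)
    {Q : Sylow p A} (hQ : PrimeChain ((Q : Subgroup A).map A.subtype) ⊤)
    {P : Sylow p G} (hQP : (Q : Subgroup A).map A.subtype ≤ P) :
    PrimeChain (P : Subgroup G) ⊤ := by
  have hP := sylow_eq_sup_inf hAB hQP
  obtain ⟨R, hR⟩ := exists_sylow_map_eq_inf P B
  set Q' := (Q : Subgroup A).map A.subtype
  set D := ⁅B, B⁆
  have hDB : D ≤ B := commutator_le_self B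
  set L := ((P : Subgroup G) ⊓ B) ⊔ D
  -- Frattini: `G` is generated by `B` and the normalizer of `P ∩ B`, both of which normalize `L`.
  have hL : L.Normal := by
    have hfr := R.normalizer_sup_eq_top
    rw [hR] at hfr
    rw [← normalizer_eq_top_iff, eq_top_iff, ← hfr]
    refine sup_le ?_ (le_normalizer_iff.2 fun b hb x hx => ?_)
    · refine le_trans ?_ (normalizer_inf_normalizer_le_normalizer_sup _ _)
      exact le_inf le_rfl le_normalizer_of_normal
    · have hxB : x ∈ B := (sup_le inf_le_right hDB : L ≤ B) hx
      have : b * x * b⁻¹ = ⁅b, x⁆ * x := by rw [commutatorElement_def]; group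
      rw [this]
      exact mul_mem (le_sup_right (a := (P : Subgroup G) ⊓ B) (commutator_mem_commutator hb hxB)) hx
  have hPD : PrimeChain ((P : Subgroup G) ⊔ D) ⊤ := by
    have h1 : (P : Subgroup G) ⊔ D = Q' ⊔ L := by
      conv_lhs => rw [hP]
      rw [sup_assoc]
    rw [h1]
    simpa using PrimeChain.sup_normal hQ L
  have hnorm : ∀ H, Q' ≤ H → (P : Subgroup G) ≤ normalizer ((H ⊓ D : Subgroup G) : Set G) := by
    intro H hH
    rw [hP]
    refine sup_le (le_normalizer_iff.2 fun q hq x hx => ⟨?_, ?_⟩)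
      (inf_le_right.trans (hB.le_normalizer inf_le_right))
    · exact mul_mem (mul_mem (hH hq) hx.1) (H.inv_mem (hH hq))
    · exact Normal.conj_mem inferInstance x hx.2 q
  have h2 := PrimeChain.sup_inf_normal hnorm le_rfl hQ
  rw [top_inf_eq, sup_eq_left.2 (inf_le_left.trans hQP)] at h2
  exact h2.trans hPD

end Cases

theorem theorem2p4 {G : Type*} [Group G] [Finite G] (A B : Subgroup G)
    (hAw : IsWSupersoluble A) (hAP : IsPSubnormal A)
    (hAB : (A : Set G) * (B : Set G) = Set.univ)
    (hB : (Group.IsNilpotent B ∧ B.Normal) ∨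
      (Group.IsNilpotent B ∧ B.index.Prime) ∨
      (B.Normal ∧ IsSiding B)) :
    IsWSupersoluble G := by
  intro p hp P₀
  have : Fact p.Prime := ⟨hp⟩
  have hmul : ∀ x : G, ∃ a ∈ A, ∃ b ∈ B, a * b = x := fun x => by
    simpa [Set.mem_mul] using (hAB ▸ Set.mem_univ x : x ∈ (A : Set G) * (B : Set G))
  have hsup : A ⊔ B = ⊤ := eq_top_iff.2 fun x _ => by
    obtain ⟨a, ha, b, hb, rfl⟩ := hmul x
    exact mul_mem_sup ha hb
  obtain ⟨Q⟩ : Nonempty (Sylow p A) := inferInstance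
  obtain ⟨P, hQP⟩ := (Q.isPGroup'.map A.subtype).exists_le_sylow
  have hQ : PrimeChain ((Q : Subgroup A).map A.subtype) ⊤ := by
    have h := PrimeChain.map (isPSubnormal_iff_primeChain.1 (hAw p hp Q)) A.subtype_injective
    rw [← MonoidHom.range_eq_map, A.range_subtype] at h
    exact h.trans (isPSubnormal_iff_primeChain.1 hAP)
  refine isPSubnormal_iff_primeChain.2 (primeChain_top_of_sylow (P := P) ?_ P₀)
  rcases hB with ⟨_, _⟩ | ⟨_, hq⟩ | ⟨_, hs⟩
  · exact primeChain_sylow_of_nilpotent_normal hsup hQ hQP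
  · by_cases hqp : B.index = p
    · exact primeChain_sylow_of_index_eq hmul hqp hQ hQP
    · exact primeChain_sylow_of_index_ne hq hqp P
  · exact primeChain_sylow_of_siding hsup hs hQ hQP
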